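/- Let $N\ge 1$ and $k\ge 2$ be integers. A domain (connected open set) $\Omega\subseteq\mathbb R^N$ has $C^k$ boundary if it has a $C^k$ defining function, that is, a $C^k$ function $\rho:\mathbb R^N\to\mathbb R$ with $\Omega=\{\rho<0\}$, $\mathbb R^N\setminus\overline\Omega=\{\rho>0\}$ and $\nabla\rho\neq0$ on $\partial\Omega$. For a positive integer $m$, a boundary point $P$ of $\Omega$ is called convex of (finite) order $m$ if there is a $C^1$ defining function $\rho$ of $\Omega$ which is of class $C^{\max(2,m)}$ in a neighbourhood of $P$ such that, with $T=\{w\in\mathbb R^N:\nabla\rho(P)\cdot w=0\}$, (i) $\sum_{i,j}\frac{\partial^2\rho}{\partial x_i\partial x_j}(P)\,w_iw_j\ge0$ for all $w\in T$; (ii) the tangent hyperplane $P+T$ has order of contact exactly $m$ with $\partial\Omega$ at $P$: for some constant $C$, $|\rho(x)|\le C|x-P|^m$ for all $x\in P+T$ near $P$, and this fails, for every $C$, when $m$ is replaced by $m+1$. **Proposition.** Let $\Omega\subseteq\mathbb R^N$ be a bounded convex domain with $C^k$ boundary, let $P\in\partial\Omega$ be a boundary point that is convex of finite order $m$, and let $\epsilon>0$.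 Then there is a bounded convex domain $\widehat\Omega\subseteq\mathbb R^N$ with $C^k$ boundary such that (a) $\widehat\Omega\supseteq\Omega$; (b) $P\in\widehat\Omega$; (c) the new piece of boundary $\partial\widehat\Omega\setminus\overline\Omega$ is convex of finite order $m$, in the sense that each of its points is a point of $\partial\widehat\Omega$ that is convex of finite order at most $m$, and the order $m$ is attained at one of its points; (d) the Hausdorff distance of $\partial\widehat\Omega$ and $\partial\Omega$ is less than $\epsilon$. -/

import Mathlib

open Topology

namespace ConvexBumping

/-- `ρ` is a defining function of class `C^k` (`k ≥ 1`) for the set `Ω ⊆ ℝ^N`. -/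
structure IsDefiningFunction {N : ℕ} (k : ℕ) (Ω : Set (EuclideanSpace ℝ (Fin N)))
    (ρ : EuclideanSpace ℝ (Fin N) → ℝ) : Prop where
  contDiff : ContDiff ℝ (k : WithTop ℕ∞) ρ
  interior_eq : Ω = {x | ρ x < 0}
  exterior_eq : (closure Ω)ᶜ = {x | 0 < ρ x}
  fderiv_ne_zero : ∀ x ∈ frontier Ω, fderiv ℝ ρ x ≠ 0

/-- `Ω` has `C^k` boundary (`k ≥ 1`). -/
def HasCkBoundary {N : ℕ} (k : ℕ) (Ω : Set (EuclideanSpace ℝ (Fin N))) : Prop :=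
  ∃ ρ : EuclideanSpace ℝ (Fin N) → ℝ, IsDefiningFunction k Ω ρ

/-- The tangent vectors at `P` to the boundary with defining function `ρ`:
those `w` with `∑ j, (∂ρ/∂x_j)(P) * w_j = 0`. -/
def tangentVectors {N : ℕ} (ρ : EuclideanSpace ℝ (Fin N) → ℝ) (P : EuclideanSpace ℝ (Fin N)) :
    Set (EuclideanSpace ℝ (Fin N)) :=
  {w | fderiv ℝ ρ P w = 0}

/-- The tangent hyperplane, translated so that it passes through `P`. -/
def tangentHyperplane {N : ℕ} (ρ : EuclideanSpace ℝ (Fin N) → ℝ)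
    (P : EuclideanSpace ℝ (Fin N)) : Set (EuclideanSpace ℝ (Fin N)) :=
  {x | x - P ∈ tangentVectors ρ P}

/-- Analytic (weak) convexity at `P`: the real Hessian of `ρ` is positive semi-definite on the
tangent vectors at `P`. -/
def HessianNonnegOnTangent {N : ℕ} (ρ : EuclideanSpace ℝ (Fin N) → ℝ)
    (P : EuclideanSpace ℝ (Fin N)) : Prop :=
  ∀ w ∈ tangentVectors ρ P, 0 ≤ fderiv ℝ (fderiv ℝ ρ) P w w

/-- `|ρ(x)| ≤ C |x - P|^m` for the `x` near `P` in the tangent hyperplane at `P`. -/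
def ContactBound {N : ℕ} (ρ : EuclideanSpace ℝ (Fin N) → ℝ)
    (P : EuclideanSpace ℝ (Fin N)) (m : ℕ) : Prop :=
  ∃ C : ℝ, ∀ᶠ x in 𝓝[tangentHyperplane ρ P] P, |ρ x| ≤ C * ‖x - P‖ ^ m

/-- The boundary point `P` of `Ω` is convex of (finite) order `m`: the boundary is of class `C^m`
(and `C^2`, so that convexity at `P` makes sense) near `P`, it is convex at `P`, and the tangent
hyperplane has order of contact exactly `m` with it at `P`. The last two conditions do not
depend on the choice of the defining function. -/
def IsConvexOfOrder {N : ℕ} (Ω : Set (EuclideanSpace ℝ (Fin N)))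
    (P : EuclideanSpace ℝ (Fin N)) (m : ℕ) : Prop :=
  P ∈ frontier Ω ∧
    ∃ ρ : EuclideanSpace ℝ (Fin N) → ℝ, IsDefiningFunction 1 Ω ρ ∧
      ContDiffAt ℝ ((max 2 m : ℕ) : WithTop ℕ∞) ρ P ∧
      HessianNonnegOnTangent ρ P ∧
      ContactBound ρ P m ∧ ¬ ContactBound ρ P (m + 1)

end ConvexBumping

/-!
# Enlarging a convex domain near a boundary point of finite order

The larger domain is `{F < 0}` for a convex function `F`, whose boundary need not coincide with that
of `Ω` anywhere. For such an `F` everything but the order of contact is automatic: the sublevel set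
is convex, `F` is a defining function (`isDefiningFunction_of_convexOn`), and its Hessian is
nonnegative. If moreover `F < 0` on `closure Ω` and `F > 0` at the points at distance `ε / 3` from
it, then `{F < 0}` contains `closure Ω`, stays `ε / 3`-close to it, and supporting hyperplanes of
`Ω` bound the Hausdorff distance of the boundaries (`hausdorffEDist_frontier_le`).

The function is `F = H + B L + δ Ψ - c / 2` (`exists_convex_function`). Here `H` is a sum of
finitely many convex functions of affine forms, zero near `closure Ω` and at least `c` at distance
`ε / 3` (`exists_convex_barrier`); `L` is a convex function of a single affine form whose level set
passes through a point `Q` slightly above `P`; and `Ψ x = ∑ j, |x j - Q j| ^ q`. By Clarkson's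
inequality, the second differences of `F` dominate `q`-th powers, so with `q < m + 1` every boundary
point has order at most `m` (`not_contactBound_of_le_second_difference`). Near `Q` only `L` and `Ψ`
vary, and `L` is constant on the tangent hyperplane, where `F` is therefore equal to `δ Ψ`: as
`q ≥ m`, the order at `Q` is exactly `m`.

The exponent has to make `|t| ^ q` of class `C ^ max k m` (`exists_contDiff_abs_rpow`). For even `m`
it is `q = m`. For odd `m` it is `q = m + 1 / 2`, which gives a function of class `C ^ m` only. That
is enough if `k ≤ m`; and `k > m` is impossible for odd `m`, since the Taylor polynomial of degree
`m` of a defining function on a tangent hyperplane of a convex domain would change sign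
(`IsConvexOfOrder.even_of_hasCkBoundary`). The parity argument transfers the order of contact from
one defining function to another (`ContactBound.of_isDefiningFunction`).
-/

namespace ConvexBumping

open Set Filter Metric

/-! ### Comparing defining functions of the same domain -/

lemma _root_.DifferentiableAt.hasDerivAt_comp_add_smul {E : Type*} [NormedAddCommGroup E]
    [NormedSpace ℝ E] {f : E → ℝ} {x : E} (hf : DifferentiableAt ℝ f x) (w : E) :
    HasDerivAt (fun s : ℝ => f (x + s • w)) (fderiv ℝ f x w) 0 := by
  have hd : HasFDerivAt f (fderiv ℝ f x) (x + (0 : ℝ) • w) := by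
    simpa using hf.hasFDerivAt
  have hl : HasDerivAt (fun s : ℝ => x + s • w) w 0 := by
    simpa using ((hasDerivAt_id (0 : ℝ)).smul_const w).const_add x
  exact hd.comp_hasDerivAt 0 hl

lemma IsDefiningFunction.eq_zero_iff {N k : ℕ} {Ω : Set (EuclideanSpace ℝ (Fin N))}
    {ρ : EuclideanSpace ℝ (Fin N) → ℝ} (h : IsDefiningFunction k Ω ρ)
    (x : EuclideanSpace ℝ (Fin N)) : ρ x = 0 ↔ x ∈ frontier Ω := by
  have ho : IsOpen Ω := by
    rw [h.interior_eq]; exact isOpen_lt h.contDiff.continuous continuous_const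
  have h1 : x ∈ Ω ↔ ρ x < 0 := by
    conv_lhs => rw [h.interior_eq]
    rfl
  have h2 : x ∉ closure Ω ↔ 0 < ρ x := by
    rw [← mem_compl_iff, h.exterior_eq]; rfl
  rw [ho.frontier_eq, Set.mem_sdiff, h1, ← not_iff_not, not_and_or, h2, not_not]
  exact lt_or_lt_iff_ne.symm.trans or_comm

lemma IsDefiningFunction.of_le {N k l : ℕ} {Ω : Set (EuclideanSpace ℝ (Fin N))}
    {ρ : EuclideanSpace ℝ (Fin N) → ℝ} (h : IsDefiningFunction k Ω ρ) (hl : l ≤ k) :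
    IsDefiningFunction l Ω ρ :=
  ⟨h.contDiff.of_le (by exact_mod_cast hl), h.interior_eq, h.exterior_eq, h.fderiv_ne_zero⟩

/-- Two defining functions of the same domain are comparable near a boundary point: from a
point `x`, a zero of `ρ₂`, which is also one of `ρ₁`, is found at a distance `O(|ρ₂ x|)`. -/
lemma IsDefiningFunction.abs_le_mul_abs {N : ℕ} {Ω : Set (EuclideanSpace ℝ (Fin N))}
    {ρ₁ ρ₂ : EuclideanSpace ℝ (Fin N) → ℝ} (h₁ : IsDefiningFunction 1 Ω ρ₁)
    (h₂ : IsDefiningFunction 1 Ω ρ₂) {P : EuclideanSpace ℝ (Fin N)} (hP : P ∈ frontier Ω) :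
    ∃ C, 0 ≤ C ∧ ∀ᶠ x in 𝓝 P, |ρ₁ x| ≤ C * |ρ₂ x| := by
  obtain ⟨K, t, ht, hK⟩ := (h₁.contDiff.contDiffAt (x := P)).exists_lipschitzOnWith
  have hstrict := (h₂.contDiff.contDiffAt (x := P)).hasStrictFDerivAt (by simp)
  set L := fderiv ℝ ρ₂ P with hL
  obtain ⟨v, hv⟩ : ∃ v, L v = 1 := by
    obtain ⟨v, hv⟩ := DFunLike.ne_iff.1 (h₂.fderiv_ne_zero P hP)
    exact ⟨(L v)⁻¹ • v, by rw [map_smul, smul_eq_mul]; exact inv_mul_cancel₀ hv⟩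
  have hv0 : 0 < ‖v‖ := by
    rw [norm_pos_iff]; rintro rfl; simp at hv
  have hc : 0 < (2 * ‖v‖)⁻¹ := by positivity
  have hlit := hstrict.isLittleO.def hc
  rw [nhds_prod_eq] at hlit
  obtain ⟨s, hs, hsb⟩ := hlit.exists_mem
  obtain ⟨a, ha, b, hb, hab⟩ := Filter.mem_prod_iff.1 hs
  obtain ⟨δ, hδ, hball⟩ := Metric.mem_nhds_iff.1 (inter_mem (inter_mem ha hb) ht)
  have hsmall : ∀ᶠ x in 𝓝 P, ‖x - P‖ + ‖(2 * ρ₂ x) • v‖ < δ := by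
    have hcont : Continuous fun x => ‖x - P‖ + ‖(2 * ρ₂ x) • v‖ := by
      have := h₂.contDiff.continuous
      fun_prop
    have h0 : ‖P - P‖ + ‖(2 * ρ₂ P) • v‖ < δ := by
      rw [(h₂.eq_zero_iff P).2 hP]; simpa using hδ
    exact hcont.continuousAt.eventually_lt continuousAt_const h0
  refine ⟨K * (2 * ‖v‖), by positivity, ?_⟩
  filter_upwards [hsmall] with x hx
  set r := ρ₂ x with hr
  have hin : ∀ τ ∈ uIcc 0 (2 * r), x - τ • v ∈ ball P δ := by
    intro τ hτ
    have h1 : |τ| ≤ |2 * r| := by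
      have := abs_sub_left_of_mem_uIcc hτ
      simpa using this
    rw [mem_ball_iff_norm]
    calc ‖x - τ • v - P‖ = ‖(x - P) - τ • v‖ := by congr 1; abel
      _ ≤ ‖x - P‖ + ‖τ • v‖ := norm_sub_le _ _
      _ ≤ ‖x - P‖ + ‖(2 * r) • v‖ := by
        rw [norm_smul, norm_smul, Real.norm_eq_abs, Real.norm_eq_abs]; gcongr
      _ < δ := hx
  have hx0 : x ∈ ball P δ := by simpa using hin 0 left_mem_uIcc
  have hend : |ρ₂ (x - (2 * r) • v) + r| ≤ |r| := by
    have h1 := hsb _ (hab (mk_mem_prod (hball (hin _ right_mem_uIcc)).1.1 (hball hx0).1.2))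
    simp only [sub_sub_cancel_left, map_neg, map_smul, hv, norm_neg, norm_smul,
      Real.norm_eq_abs, smul_eq_mul, mul_one] at h1
    calc |ρ₂ (x - (2 * r) • v) + r| = |ρ₂ (x - (2 * r) • v) - ρ₂ x - -(2 * r)| := by
          congr 1; rw [← hr]; ring
      _ ≤ _ := h1
      _ = |r| := by rw [abs_mul, abs_two]; field_simp
  have hzero : (0 : ℝ) ∈ uIcc (ρ₂ (x - (0 : ℝ) • v)) (ρ₂ (x - (2 * r) • v)) := by
    rw [zero_smul, sub_zero, ← hr, mem_uIcc]
    rcases le_total 0 r with h0 | h0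
    · rw [abs_of_nonneg h0] at hend
      right; constructor <;> linarith [(abs_le.1 hend).2]
    · rw [abs_of_nonpos h0] at hend
      left; constructor <;> linarith [(abs_le.1 hend).1]
  obtain ⟨τ, hτ, hτ0⟩ := intermediate_value_uIcc (f := fun τ : ℝ => ρ₂ (x - τ • v))
    (by have := h₂.contDiff.continuous; fun_prop) hzero
  have hρ₁ : ρ₁ (x - τ • v) = 0 := (h₁.eq_zero_iff _).2 ((h₂.eq_zero_iff _).1 hτ0)
  have hlip := hK.dist_le_mul x (hball hx0).2 _ (hball (hin τ hτ)).2
  rw [hρ₁, Real.dist_eq, sub_zero, dist_eq_norm, sub_sub_cancel, norm_smul,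
    Real.norm_eq_abs] at hlip
  have h1 : |τ| ≤ 2 * |r| := by
    have := abs_sub_left_of_mem_uIcc hτ
    simpa [abs_mul] using this
  calc |ρ₁ x| ≤ K * (|τ| * ‖v‖) := hlip
    _ ≤ K * ((2 * |r|) * ‖v‖) := by gcongr
    _ = K * (2 * ‖v‖) * |r| := by ring

lemma IsDefiningFunction.tangentVectors_subset {N : ℕ} {Ω : Set (EuclideanSpace ℝ (Fin N))}
    {ρ₁ ρ₂ : EuclideanSpace ℝ (Fin N) → ℝ} (h₁ : IsDefiningFunction 1 Ω ρ₁)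
    (h₂ : IsDefiningFunction 1 Ω ρ₂) {P : EuclideanSpace ℝ (Fin N)} (hP : P ∈ frontier Ω) :
    tangentVectors ρ₂ P ⊆ tangentVectors ρ₁ P := by
  intro w hw
  obtain ⟨C, hC, hle⟩ := h₁.abs_le_mul_abs h₂ hP
  have hline : ∀ ρ : EuclideanSpace ℝ (Fin N) → ℝ, IsDefiningFunction 1 Ω ρ →
      HasDerivAt (fun s : ℝ => ρ (P + s • w)) (fderiv ℝ ρ P w) 0 :=
    fun ρ h => (h.contDiff.differentiable (by simp) P).hasDerivAt_comp_add_smul w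
  have hρ : ∀ ρ : EuclideanSpace ℝ (Fin N) → ℝ, IsDefiningFunction 1 Ω ρ → ρ P = 0 :=
    fun ρ h => (h.eq_zero_iff P).2 hP
  have hd₂ := hline ρ₂ h₂
  rw [show fderiv ℝ ρ₂ P w = 0 from hw, hasDerivAt_iff_isLittleO] at hd₂
  have hd₁ : HasDerivAt (fun s : ℝ => ρ₁ (P + s • w)) 0 0 := by
    rw [hasDerivAt_iff_isLittleO]
    refine Asymptotics.IsBigO.trans_isLittleO ?_ hd₂
    refine Asymptotics.IsBigO.of_bound C ?_
    have ht : Tendsto (fun s : ℝ => P + s • w) (𝓝 0) (𝓝 P) :=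
      Continuous.tendsto' (by fun_prop) _ _ (by simp)
    filter_upwards [ht.eventually hle] with s hs
    simpa [hρ ρ₁ h₁, hρ ρ₂ h₂] using hs
  exact (hline ρ₁ h₁).unique hd₁

/-- The order of contact does not depend on the defining function. -/
lemma ContactBound.of_isDefiningFunction {N m : ℕ} {Ω : Set (EuclideanSpace ℝ (Fin N))}
    {ρ₁ ρ₂ : EuclideanSpace ℝ (Fin N) → ℝ} (h₁ : IsDefiningFunction 1 Ω ρ₁)
    (h₂ : IsDefiningFunction 1 Ω ρ₂) {P : EuclideanSpace ℝ (Fin N)} (hP : P ∈ frontier Ω)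
    (h : ContactBound ρ₂ P m) : ContactBound ρ₁ P m := by
  obtain ⟨C, hC⟩ := h
  obtain ⟨D, hD, hle⟩ := h₁.abs_le_mul_abs h₂ hP
  have hsub : tangentHyperplane ρ₁ P ⊆ tangentHyperplane ρ₂ P :=
    fun x hx => h₂.tangentVectors_subset h₁ hP hx
  refine ⟨D * C, ?_⟩
  filter_upwards [nhdsWithin_mono P hsub hC, nhdsWithin_le_nhds hle] with x h3 h4
  calc |ρ₁ x| ≤ D * |ρ₂ x| := h4
    _ ≤ D * (C * ‖x - P‖ ^ m) := by gcongr
    _ = D * C * ‖x - P‖ ^ m := by ring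

/-! ### Parity of the order of contact -/

/-- Taylor's formula with a remainder that is uniform in the direction. -/
lemma exists_abs_sub_taylor_le {E : Type*} [NormedAddCommGroup E] [NormedSpace ℝ E]
    [ProperSpace E] {m : ℕ} {f : E → ℝ} (hf : ContDiff ℝ ((m + 1 : ℕ) : WithTop ℕ∞) f) :
    ∃ C, ∀ w : E, ‖w‖ ≤ 1 →
      |f w - ∑ j ∈ Finset.range (m + 1),
        ((j.factorial : ℝ)⁻¹ * iteratedFDeriv ℝ j f 0 fun _ => w)| ≤ C * ‖w‖ ^ (m + 1) := by
  have hcont : Continuous fun x => iteratedFDeriv ℝ (m + 1) f x :=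
    hf.continuous_iteratedFDeriv le_rfl
  obtain ⟨M, hM⟩ := (isCompact_closedBall (0 : E) 1).exists_bound_of_continuousOn
    hcont.continuousOn
  refine ⟨M / m.factorial, fun w hw => ?_⟩
  let g : ℝ →L[ℝ] E := ContinuousLinearMap.toSpanSingleton ℝ w
  have hg : ∀ s, g s = s • w := fun s => by simp [g]
  have hfg : ContDiff ℝ ((m + 1 : ℕ) : WithTop ℕ∞) (f ∘ g) := hf.comp g.contDiff
  have hder : ∀ j ≤ m + 1, ∀ s ∈ Icc (0 : ℝ) 1, iteratedDerivWithin j (f ∘ g) (Icc 0 1) s =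
      iteratedFDeriv ℝ j f (s • w) fun _ => w := by
    intro j hj s hs
    have hj' : ((j : ℕ) : WithTop ℕ∞) ≤ ((m + 1 : ℕ) : WithTop ℕ∞) := by exact_mod_cast hj
    rw [iteratedDerivWithin_eq_iteratedDeriv (uniqueDiffOn_Icc one_pos)
      ((hfg.of_le hj').contDiffAt) hs, iteratedDeriv_eq_iteratedFDeriv,
      g.iteratedFDeriv_comp_right hf s hj', hg]
    simp [ContinuousMultilinearMap.compContinuousLinearMap_apply, g]
  have hT := taylor_mean_remainder_bound (f := f ∘ g) (n := m) (C := M * ‖w‖ ^ (m + 1))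
    zero_le_one hfg.contDiffOn (right_mem_Icc.2 zero_le_one) (by
      intro s hs
      rw [hder _ le_rfl s hs]
      refine (ContinuousMultilinearMap.le_opNorm _ _).trans ?_
      rw [Finset.prod_const, Finset.card_univ, Fintype.card_fin]
      gcongr
      apply hM
      rw [mem_closedBall_zero_iff, norm_smul, Real.norm_eq_abs, abs_of_nonneg hs.1]
      nlinarith [hs.2, hs.1, norm_nonneg w])
  have hsum : taylorWithinEval (f ∘ g) m (Icc 0 1) 0 1 = ∑ j ∈ Finset.range (m + 1),
      ((j.factorial : ℝ)⁻¹ * iteratedFDeriv ℝ j f 0 fun _ => w) := by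
    rw [taylor_within_apply]
    refine Finset.sum_congr rfl fun j hj => ?_
    rw [hder j (Finset.mem_range.1 hj).le 0 (left_mem_Icc.2 zero_le_one)]
    simp
  rw [hsum, Real.norm_eq_abs] at hT
  simp only [Function.comp_apply, hg, one_smul, sub_zero, one_pow, mul_one] at hT
  calc _ ≤ _ := hT
    _ = _ := by ring

/-- For odd `m`, a polynomial of degree at most `m` that is `O(|s| ^ m)` and nonnegative up to
`O(|s| ^ (m + 1))` vanishes. -/
lemma coeff_eq_zero_of_odd {m : ℕ} (hm : Odd m) {a : ℕ → ℝ} {C D : ℝ}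
    (hC : ∀ᶠ s in 𝓝 (0 : ℝ), |∑ j ∈ Finset.range (m + 1), a j * s ^ j| ≤ C * |s| ^ m)
    (hD : ∀ᶠ s in 𝓝 (0 : ℝ), -(D * |s| ^ (m + 1)) ≤ ∑ j ∈ Finset.range (m + 1), a j * s ^ j) :
    ∀ j ≤ m, a j = 0 := by
  intro n
  induction n using Nat.strong_induction_on with
  | _ n ih =>
  intro hn
  -- `H s` is the polynomial divided by `s ^ n`; its value at `0` is `a n`.
  let H : ℝ → ℝ := fun s => ∑ j ∈ Finset.range (m + 1), a j * s ^ (j - n)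
  have hH0 : H 0 = a n := by
    simp only [H]
    rw [Finset.sum_eq_single n]
    · simp
    · intro j hj hjn
      rcases lt_or_gt_of_ne hjn with h | h
      · rw [ih j h (by omega), zero_mul]
      · rw [zero_pow (by omega), mul_zero]
    · intro h; exact absurd (Finset.mem_range.2 (by omega)) h
  have hmul : ∀ s, ∑ j ∈ Finset.range (m + 1), a j * s ^ j = s ^ n * H s := by
    intro s
    rw [Finset.mul_sum]
    refine Finset.sum_congr rfl fun j hj => ?_
    rcases lt_or_ge j n with h | h
    · rw [ih j h (by omega)]; ring
    · rw [mul_left_comm, ← pow_add, Nat.add_sub_cancel' h]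
  have hcont : Tendsto H (𝓝 0) (𝓝 (a n)) :=
    Continuous.tendsto' (by fun_prop) _ _ hH0
  simp only [hmul] at hC hD
  rcases hn.lt_or_eq with hlt | rfl
  · have hz : Tendsto (fun s : ℝ => C * |s| ^ (m - n)) (𝓝 0) (𝓝 0) :=
      Continuous.tendsto' (by fun_prop) _ _ (by simp [show m - n ≠ 0 by omega])
    have habs : |a n| ≤ 0 := by
      refine le_of_tendsto_of_tendsto (b := 𝓝[≠] (0 : ℝ))
        (hcont.abs.mono_left nhdsWithin_le_nhds) (hz.mono_left nhdsWithin_le_nhds) ?_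
      filter_upwards [nhdsWithin_le_nhds hC, self_mem_nhdsWithin] with s hs hs0
      have hpos : 0 < |s| ^ n := pow_pos (abs_pos.2 hs0) n
      rw [abs_mul, abs_pow] at hs
      refine le_of_mul_le_mul_left (hs.trans_eq ?_) hpos
      rw [mul_left_comm, ← pow_add, Nat.add_sub_cancel' hlt.le]
    exact abs_nonpos_iff.1 habs
  · have hz : Tendsto (fun s : ℝ => D * |s|) (𝓝 0) (𝓝 0) :=
      Continuous.tendsto' (by fun_prop) _ _ (by simp)
    have hz' : Tendsto (fun s : ℝ => -(D * |s|)) (𝓝 0) (𝓝 0) := by simpa using hz.neg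
    apply le_antisymm
    · refine le_of_tendsto_of_tendsto (b := 𝓝[<] (0 : ℝ))
        (hcont.mono_left nhdsWithin_le_nhds) (hz.mono_left nhdsWithin_le_nhds) ?_
      filter_upwards [nhdsWithin_le_nhds hD, self_mem_nhdsWithin] with s hs hs0
      have hpos : 0 < |s| ^ n := pow_pos (abs_pos.2 (ne_of_lt hs0)) n
      have hpow : s ^ n = -|s| ^ n := by
        rw [abs_of_neg hs0, hm.neg_pow, neg_neg]
      rw [hpow, pow_succ] at hs
      refine le_of_mul_le_mul_left ?_ hpos
      linarith
    · refine le_of_tendsto_of_tendsto (b := 𝓝[>] (0 : ℝ))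
        (hz'.mono_left nhdsWithin_le_nhds) (hcont.mono_left nhdsWithin_le_nhds) ?_
      filter_upwards [nhdsWithin_le_nhds hD, self_mem_nhdsWithin] with s hs hs0
      have hpos : 0 < |s| ^ n := pow_pos (abs_pos.2 (ne_of_gt hs0)) n
      have hpow : s ^ n = |s| ^ n := by rw [abs_of_pos hs0]
      rw [hpow, pow_succ] at hs
      refine le_of_mul_le_mul_left ?_ hpos
      linarith

/-- The tangent hyperplane of a convex domain does not meet the domain. -/
lemma IsDefiningFunction.nonneg_of_mem_tangentHyperplane {N : ℕ}
    {Ω : Set (EuclideanSpace ℝ (Fin N))} {ρ : EuclideanSpace ℝ (Fin N) → ℝ}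
    (h : IsDefiningFunction 1 Ω ρ) (hopen : IsOpen Ω) (hconv : Convex ℝ Ω)
    {P : EuclideanSpace ℝ (Fin N)} (hP : P ∈ frontier Ω) {x : EuclideanSpace ℝ (Fin N)}
    (hx : x ∈ tangentHyperplane ρ P) : 0 ≤ ρ x := by
  by_contra! hneg
  have hxΩ : x ∈ Ω := by rw [h.interior_eq]; exact hneg
  obtain ⟨v, hv⟩ : ∃ v, 0 < fderiv ℝ ρ P v := by
    obtain ⟨v, hv⟩ := DFunLike.ne_iff.1 (h.fderiv_ne_zero P hP)
    rcases lt_or_gt_of_ne hv with h0 | h0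
    · exact ⟨-v, by rw [map_neg]; simpa using h0⟩
    · exact ⟨v, h0⟩
  -- Tilt the direction `x - P` slightly outwards, keeping its end point in `Ω`.
  have htend : Tendsto (fun η : ℝ => x + η • v) (𝓝[>] 0) (𝓝 x) :=
    (Continuous.tendsto' (by fun_prop) _ _ (by simp)).mono_left nhdsWithin_le_nhds
  obtain ⟨η, hη, hη0⟩ := ((htend.eventually (hopen.mem_nhds hxΩ)).and self_mem_nhdsWithin).exists
  set w := x + η • v - P with hw
  have hdw : 0 < fderiv ℝ ρ P w := by
    have h0 : fderiv ℝ ρ P (x - P) = 0 := hx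
    have : w = (x - P) + η • v := by rw [hw]; abel
    rw [this, map_add, h0, map_smul, zero_add, smul_eq_mul]
    exact mul_pos hη0 hv
  have hd : HasDerivAt (fun s : ℝ => ρ (P + s • w)) (fderiv ℝ ρ P w) 0 :=
    (h.contDiff.differentiable (by simp) P).hasDerivAt_comp_add_smul w
  have hle : fderiv ℝ ρ P w ≤ 0 := by
    refine le_of_tendsto (hd.tendsto_slope.mono_left (nhdsGT_le_nhdsNE 0)) ?_
    filter_upwards [Ioo_mem_nhdsGT (one_pos : (0 : ℝ) < 1)] with s hs
    have hmem : P + s • w ∈ Ω := by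
      have := hconv.add_smul_sub_mem_interior' (frontier_subset_closure hP)
        (by rw [hopen.interior_eq]; exact hη) ⟨hs.1, hs.2.le⟩
      rwa [hopen.interior_eq] at this
    have hneg' : ρ (P + s • w) < 0 := by rw [h.interior_eq] at hmem; exact hmem
    rw [slope_def_field, zero_smul, add_zero, (h.eq_zero_iff P).2 hP, sub_zero, sub_zero]
    exact (div_neg_of_neg_of_pos hneg' hs.1).le
  exact absurd hdw hle.not_gt

/-- If the boundary of a convex domain is of class `C ^ (m + 1)`, a finite order of contact `m`
is even: the term of degree `m` of the Taylor expansion of the defining function on the tangent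
hyperplane does not change sign. -/
lemma IsConvexOfOrder.even_of_hasCkBoundary {N k m : ℕ} {Ω : Set (EuclideanSpace ℝ (Fin N))}
    (hopen : IsOpen Ω) (hconv : Convex ℝ Ω) (hCk : HasCkBoundary k Ω) (hmk : m < k)
    {P : EuclideanSpace ℝ (Fin N)} (hP : IsConvexOfOrder Ω P m) : Even m := by
  by_contra hodd
  rw [Nat.not_even_iff_odd] at hodd
  obtain ⟨hPf, ρ₁, h₁, -, -, hb, hnb⟩ := hP
  obtain ⟨ρ, hρ⟩ := hCk
  have hρ1 : IsDefiningFunction 1 Ω ρ := hρ.of_le (by omega)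
  apply hnb
  refine ContactBound.of_isDefiningFunction h₁ hρ1 hPf ?_
  replace hb := ContactBound.of_isDefiningFunction hρ1 h₁ hPf hb
  obtain ⟨C, hC⟩ := hb
  let f : EuclideanSpace ℝ (Fin N) → ℝ := fun w => ρ (P + w)
  have hf : ContDiff ℝ ((m + 1 : ℕ) : WithTop ℕ∞) f :=
    (hρ.contDiff.of_le (by exact_mod_cast hmk)).comp (contDiff_const.add contDiff_id)
  obtain ⟨D, hD⟩ := exists_abs_sub_taylor_le hf
  let a : EuclideanSpace ℝ (Fin N) → ℕ → ℝ := fun w j =>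
    (j.factorial : ℝ)⁻¹ * iteratedFDeriv ℝ j f 0 fun _ => w
  have ha : ∀ (w : EuclideanSpace ℝ (Fin N)) (s : ℝ) (j : ℕ), a (s • w) j = a w j * s ^ j := by
    intro w s j
    simp only [a]
    rw [ContinuousMultilinearMap.map_smul_univ (iteratedFDeriv ℝ j f 0) (fun _ => s) (fun _ => w)]
    simp only [Finset.prod_const, Finset.card_univ, Fintype.card_fin, smul_eq_mul]
    ring
  have hvanish : ∀ w ∈ tangentVectors ρ P, ∀ j ≤ m, a w j = 0 := by
    intro w hw
    have hmem : ∀ s : ℝ, P + s • w ∈ tangentHyperplane ρ P := by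
      intro s
      change fderiv ℝ ρ P (P + s • w - P) = 0
      rw [add_sub_cancel_left, map_smul, show fderiv ℝ ρ P w = 0 from hw, smul_zero]
    have hline : Tendsto (fun s : ℝ => P + s • w) (𝓝 0) (𝓝[tangentHyperplane ρ P] P) :=
      tendsto_nhdsWithin_iff.2 ⟨Continuous.tendsto' (by fun_prop) _ _ (by simp),
        Eventually.of_forall hmem⟩
    have hsmall : ∀ᶠ s : ℝ in 𝓝 0, ‖s • w‖ < 1 :=
      (Continuous.continuousAt (by fun_prop)).eventually_lt continuousAt_const (by simp)
    have htay : ∀ᶠ s : ℝ in 𝓝 0, |f (s • w) - ∑ j ∈ Finset.range (m + 1), a w j * s ^ j| ≤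
        D * ‖w‖ ^ (m + 1) * |s| ^ (m + 1) := by
      filter_upwards [hsmall] with s hs
      have := hD _ hs.le
      simp only [← ha]
      refine this.trans_eq ?_
      rw [norm_smul, mul_pow, Real.norm_eq_abs]; ring
    refine coeff_eq_zero_of_odd hodd (C := C * ‖w‖ ^ m + |D| * ‖w‖ ^ (m + 1))
      (D := D * ‖w‖ ^ (m + 1)) ?_ ?_
    · have hs1 : ∀ᶠ s : ℝ in 𝓝 0, |s| < 1 :=
        continuous_abs.continuousAt.eventually_lt continuousAt_const (by simp)
      filter_upwards [htay, hline.eventually hC, hs1] with s h2 h3 h4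
      rw [add_sub_cancel_left, norm_smul, mul_pow, Real.norm_eq_abs] at h3
      have h5 : D * ‖w‖ ^ (m + 1) * |s| ^ (m + 1) ≤ |D| * ‖w‖ ^ (m + 1) * |s| ^ m := by
        refine mul_le_mul (by gcongr; exact le_abs_self D)
          (pow_le_pow_of_le_one (abs_nonneg s) h4.le (Nat.le_succ m)) (by positivity)
          (by positivity)
      have h6 := abs_sub_abs_le_abs_sub (∑ j ∈ Finset.range (m + 1), a w j * s ^ j) (f (s • w))
      rw [abs_sub_comm] at h6
      have h7 : |f (s • w)| ≤ C * (|s| ^ m * ‖w‖ ^ m) := h3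
      linarith
    · filter_upwards [htay] with s h2
      have h3 : 0 ≤ f (s • w) :=
        hρ1.nonneg_of_mem_tangentHyperplane hopen hconv hPf (hmem s)
      have := (abs_le.1 h2).2
      linarith
  refine ⟨D, ?_⟩
  filter_upwards [self_mem_nhdsWithin, nhdsWithin_le_nhds (closedBall_mem_nhds P one_pos)]
    with x hx hx1
  have := hD (x - P) (by simpa [dist_eq_norm] using hx1)
  rw [Finset.sum_eq_zero (fun j hj => hvanish _ hx j (by simpa [Nat.lt_succ_iff] using hj)),
    sub_zero] at this
  simpa [f] using this

/-! ### Two kinds of convex functions of one variable -/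

/-- The exponent `q ∈ [m, m + 1)` governs the order of the flat point to be built. For even `m`
it is `m`; for odd `m` no smooth convex function works, and it is `m + 1 / 2`. -/
lemma exists_contDiff_abs_rpow {k m : ℕ} (h : Even m ∨ k ≤ m) :
    ∃ q : ℝ, (m : ℝ) ≤ q ∧ q < m + 1 ∧
      ContDiff ℝ ((max k m : ℕ) : WithTop ℕ∞) fun t : ℝ => |t| ^ q := by
  by_cases hm : Even m
  · refine ⟨m, le_rfl, by linarith, ?_⟩
    simp only [Real.rpow_natCast, hm.pow_abs]
    fun_prop
  · have hk : max k m = m := max_eq_right (h.resolve_left hm)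
    rw [hk]
    refine ⟨m + 1 / 2, by linarith, by linarith, ?_⟩
    -- For a half-integer exponent, Mathlib's real power vanishes on the negative half-line.
    have hcos : Real.cos (((m : ℝ) + 1 / 2) * Real.pi) = 0 := by
      rw [Real.cos_eq_zero_iff]; exact ⟨m, by push_cast; ring⟩
    have hp : (m : ℝ) + 1 / 2 ≠ 0 := by positivity
    have heq : (fun t : ℝ => |t| ^ ((m : ℝ) + 1 / 2)) =
        fun t => t ^ ((m : ℝ) + 1 / 2) + (-t) ^ ((m : ℝ) + 1 / 2) := by
      funext t
      rcases lt_trichotomy t 0 with ht | rfl | ht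
      · rw [Real.rpow_def_of_neg ht, hcos, abs_of_neg ht]; ring
      · rw [abs_zero, neg_zero, Real.zero_rpow hp, add_zero]
      · rw [Real.rpow_def_of_neg (neg_lt_zero.2 ht), hcos, abs_of_pos ht]; ring
    rw [heq]
    have hc : ContDiff ℝ m fun t : ℝ => t ^ ((m : ℝ) + 1 / 2) :=
      Real.contDiff_rpow_const_of_le (by linarith)
    exact hc.add (hc.comp contDiff_neg)

/-- A convex function of class `C ^ n` that vanishes exactly on the negative half-line. -/
lemma exists_convex_cutoff (n : ℕ) (hn : 1 ≤ n) :
    ∃ χ : ℝ → ℝ, ContDiff ℝ n χ ∧ ConvexOn ℝ univ χ ∧ (∀ t ≤ 0, χ t = 0) ∧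
      ∀ t, 0 < t → 0 < χ t := by
  have hn' : (1 : ℝ) ≤ n := by exact_mod_cast hn
  have hp : (1 : ℝ) ≤ (n : ℝ) + 1 / 2 := by linarith
  -- Mathlib's real power with the exponent `n + 1 / 2` is zero at negative arguments.
  have hcos : Real.cos (((n : ℝ) + 1 / 2) * Real.pi) = 0 := by
    rw [Real.cos_eq_zero_iff]; exact ⟨n, by push_cast; ring⟩
  have hneg : ∀ t : ℝ, t ≤ 0 → t ^ ((n : ℝ) + 1 / 2) = 0 := by
    intro t ht
    rcases ht.lt_or_eq with h | rfl
    · rw [Real.rpow_def_of_neg h, hcos, mul_zero]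
    · exact Real.zero_rpow (by linarith)
  refine ⟨fun t => t ^ ((n : ℝ) + 1 / 2), Real.contDiff_rpow_const_of_le (by linarith), ?_, hneg,
    fun t ht => Real.rpow_pos_of_pos ht _⟩
  have hmax : (fun t : ℝ => t ^ ((n : ℝ) + 1 / 2)) = fun t => (max t 0) ^ ((n : ℝ) + 1 / 2) := by
    funext t
    rcases le_total t 0 with h | h
    · rw [max_eq_right h, hneg t h, hneg 0 le_rfl]
    · rw [max_eq_left h]
  rw [hmax]
  refine ⟨convex_univ, fun x _ y _ a b ha hb hab => ?_⟩
  refine le_trans ?_ ((convexOn_rpow hp).2 (le_max_right x 0) (le_max_right y 0) ha hb hab)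
  refine Real.rpow_le_rpow (le_max_right _ _) (max_le ?_ ?_) (by linarith)
  · simp only [smul_eq_mul]; gcongr <;> exact le_max_left _ _
  · have := le_max_right x 0
    have := le_max_right y 0
    simp only [smul_eq_mul]; positivity

lemma convexOn_abs_rpow {q : ℝ} (hq : 1 ≤ q) : ConvexOn ℝ univ fun t : ℝ => |t| ^ q := by
  refine ⟨convex_univ, fun x _ y _ a b ha hb hab => ?_⟩
  refine le_trans ?_ ((convexOn_rpow hq).2 (abs_nonneg x) (abs_nonneg y) ha hb hab)
  refine Real.rpow_le_rpow (abs_nonneg _) ?_ (by linarith)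
  refine (abs_add_le _ _).trans_eq ?_
  simp only [smul_eq_mul, abs_mul, abs_of_nonneg ha, abs_of_nonneg hb]

/-- Clarkson's inequality on the line, which expresses uniform convexity of power type `q`. -/
lemma two_mul_abs_rpow_add_le {q : ℝ} (hq : 2 ≤ q) (a b : ℝ) :
    2 * |a| ^ q + 2 * |b| ^ q ≤ |a + b| ^ q + |a - b| ^ q := by
  have hsq : ∀ t : ℝ, |t| ^ q = (t ^ 2) ^ (q / 2) := by
    intro t
    rw [← sq_abs, ← Real.rpow_natCast, ← Real.rpow_mul (abs_nonneg t)]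
    congr 1; push_cast; ring
  have hq2 : 1 ≤ q / 2 := by linarith
  simp only [hsq]
  have h1 := Real.add_rpow_le_rpow_add (sq_nonneg a) (sq_nonneg b) hq2
  have h2 := (convexOn_rpow hq2).2 (mem_Ici.2 (sq_nonneg (a + b))) (mem_Ici.2 (sq_nonneg (a - b)))
    (show (0 : ℝ) ≤ 1 / 2 by norm_num) (show (0 : ℝ) ≤ 1 / 2 by norm_num) (by norm_num)
  simp only [smul_eq_mul] at h2
  rw [show 1 / 2 * (a + b) ^ 2 + 1 / 2 * (a - b) ^ 2 = a ^ 2 + b ^ 2 by ring] at h2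
  linarith

/-! ### Sublevel sets of convex functions -/

lemma _root_.ConvexOn.add_fderiv_le {E : Type*} [NormedAddCommGroup E] [NormedSpace ℝ E]
    {F : E → ℝ} (hF : ConvexOn ℝ univ F) {x : E} (hd : DifferentiableAt ℝ F x) (y : E) :
    F x + fderiv ℝ F x (y - x) ≤ F y := by
  have h := hd.hasDerivAt_comp_add_smul (y - x)
  have hle : fderiv ℝ F x (y - x) ≤ F y - F x := by
    refine le_of_tendsto (h.tendsto_slope.mono_left (nhdsGT_le_nhdsNE 0)) ?_
    filter_upwards [Ioo_mem_nhdsGT (one_pos : (0 : ℝ) < 1)] with s hs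
    rw [slope_def_field, zero_smul, add_zero, sub_zero, div_le_iff₀ hs.1]
    have := hF.2 (mem_univ x) (mem_univ y) (sub_nonneg.2 hs.2.le) hs.1.le (by ring)
    rw [show (1 - s) • x + s • y = x + s • (y - x) by
      rw [sub_smul, smul_sub, one_smul]; abel] at this
    simp only [smul_eq_mul] at this
    linarith
  linarith

lemma isDefiningFunction_of_convexOn {N k : ℕ} (hk : 1 ≤ k) {F : EuclideanSpace ℝ (Fin N) → ℝ}
    (hF : ContDiff ℝ (k : WithTop ℕ∞) F) (hconv : ConvexOn ℝ univ F)
    {x₀ : EuclideanSpace ℝ (Fin N)} (hx₀ : F x₀ < 0) : IsDefiningFunction k {x | F x < 0} F := by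
  have hcl : closure {x | F x < 0} = {x | F x ≤ 0} := by
    apply Subset.antisymm
    · exact closure_minimal (fun x hx => le_of_lt (α := ℝ) hx)
        (isClosed_le hF.continuous continuous_const)
    · intro x hx
      have ht : Tendsto (fun s : ℝ => (1 - s) • x + s • x₀) (𝓝[>] 0) (𝓝 x) :=
        (Continuous.tendsto' (by fun_prop) _ _ (by simp)).mono_left nhdsWithin_le_nhds
      refine mem_closure_of_tendsto ht ?_
      filter_upwards [Ioo_mem_nhdsGT (one_pos : (0 : ℝ) < 1)] with s hs
      have := hconv.2 (mem_univ x) (mem_univ x₀) (sub_nonneg.2 hs.2.le) hs.1.le (by ring)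
      simp only [smul_eq_mul] at this
      have h1 : (1 - s) * F x ≤ 0 := mul_nonpos_of_nonneg_of_nonpos (sub_nonneg.2 hs.2.le) hx
      have h2 : s * F x₀ < 0 := mul_neg_of_pos_of_neg hs.1 hx₀
      exact this.trans_lt (by linarith)
  refine ⟨hF, rfl, ?_, fun x hx h0 => ?_⟩
  · rw [hcl]; ext x; simp
  · have hx' : 0 ≤ F x := by
      have := (isOpen_lt hF.continuous continuous_const).frontier_eq ▸ hx
      exact not_lt.1 this.2
    have := hconv.add_fderiv_le (hF.differentiable (by positivity) x) x₀
    rw [h0] at this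
    simp at this
    linarith

lemma hessianNonnegOnTangent_of_convexOn {N : ℕ} {F : EuclideanSpace ℝ (Fin N) → ℝ}
    (hF : ContDiff ℝ 2 F) (hconv : ConvexOn ℝ univ F) (Q : EuclideanSpace ℝ (Fin N)) :
    HessianNonnegOnTangent F Q := by
  intro w _
  have hd : Differentiable ℝ F := hF.differentiable (by simp)
  have hd2 : Differentiable ℝ (fderiv ℝ F) :=
    (hF.fderiv_right (m := 1) (by norm_num)).differentiable (by simp)
  have hG : HasFDerivAt (fun x => fderiv ℝ F x w)
      ((ContinuousLinearMap.apply ℝ ℝ w).comp (fderiv ℝ (fderiv ℝ F) Q)) Q :=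
    (ContinuousLinearMap.apply ℝ ℝ w).hasFDerivAt.comp Q (hd2 Q).hasFDerivAt
  have hder : HasDerivAt (fun s : ℝ => fderiv ℝ F (Q + s • w) w)
      (fderiv ℝ (fderiv ℝ F) Q w w) 0 := by
    have h := hG.differentiableAt.hasDerivAt_comp_add_smul w
    rwa [hG.fderiv] at h
  refine ge_of_tendsto (hder.tendsto_slope.mono_left (nhdsGT_le_nhdsNE 0)) ?_
  filter_upwards [self_mem_nhdsWithin] with s hs
  rw [slope_def_field, zero_smul, add_zero, sub_zero]
  refine div_nonneg ?_ (le_of_lt hs)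
  -- Add the gradient inequalities at `Q` and at `Q + s • w`.
  have h1 := hconv.add_fderiv_le (hd Q) (Q + s • w)
  have h2 := hconv.add_fderiv_le (hd (Q + s • w)) Q
  rw [add_sub_cancel_left, map_smul, smul_eq_mul] at h1
  rw [sub_add_cancel_left, map_neg, map_smul, smul_eq_mul] at h2
  have h3 : 0 ≤ s * (fderiv ℝ F (Q + s • w) w - fderiv ℝ F Q w) := by linarith
  exact nonneg_of_mul_nonneg_right h3 hs

lemma contactBound_two {N : ℕ} {F : EuclideanSpace ℝ (Fin N) → ℝ} {Q : EuclideanSpace ℝ (Fin N)}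
    (hF : ContDiffAt ℝ 2 F Q) (hQ : F Q = 0) : ContactBound F Q 2 := by
  obtain ⟨K, t, ht, hK⟩ := (hF.fderiv_right (m := 1) (by norm_num)).exists_lipschitzOnWith
  have hdiff : ∀ᶠ x in 𝓝 Q, DifferentiableAt ℝ F x :=
    (hF.eventually (by simp)).mono fun x hx => hx.differentiableAt (by simp)
  obtain ⟨δ, hδ, hball⟩ := Metric.mem_nhds_iff.1 (inter_mem ht hdiff)
  refine ⟨K, ?_⟩
  filter_upwards [self_mem_nhdsWithin, nhdsWithin_le_nhds (ball_mem_nhds Q hδ)] with x hx hxb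
  have hsub : closedBall Q ‖x - Q‖ ⊆ ball Q δ :=
    closedBall_subset_ball (by simpa [dist_eq_norm] using hxb)
  have := (convex_closedBall Q ‖x - Q‖).norm_image_sub_le_of_norm_fderiv_le' (f := F)
    (φ := fderiv ℝ F Q) (C := K * ‖x - Q‖) (fun y hy => (hball (hsub hy)).2) (fun y hy => by
      have := hK.dist_le_mul y (hball (hsub hy)).1 Q (hball (mem_ball_self hδ)).1
      rw [dist_eq_norm, dist_eq_norm] at this
      refine this.trans ?_
      gcongr
      simpa [dist_eq_norm] using hy) (x := Q) (y := x) (mem_closedBall_self (norm_nonneg _))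
      (by simp [dist_eq_norm])
  rw [show fderiv ℝ F Q (x - Q) = 0 from hx, hQ, sub_zero, sub_zero, Real.norm_eq_abs] at this
  rw [pow_two, ← mul_assoc]
  exact this

/-- If the second differences of `F` are bounded below by a power `q < m + 1`, then the order of
contact with the zero set is at most `m`, as soon as there is a tangent direction. -/
lemma not_contactBound_of_le_second_difference {N m : ℕ} {F : EuclideanSpace ℝ (Fin N) → ℝ}
    {Q : EuclideanSpace ℝ (Fin N)} (hQ : F Q = 0) {q c : ℝ} (hq : q < m + 1) (hc : 0 < c)
    (hF : ∀ w : EuclideanSpace ℝ (Fin N), c * ∑ j, |w j| ^ q ≤ F (Q + w) + F (Q - w) - 2 * F Q)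
    {w : EuclideanSpace ℝ (Fin N)} (hw : w ∈ tangentVectors F Q) (hw0 : w ≠ 0) :
    ¬ ContactBound F Q (m + 1) := by
  rintro ⟨C, hC⟩
  set A := ∑ j, |w j| ^ q with hA
  have hApos : 0 < A := by
    obtain ⟨j, hj⟩ : ∃ j, w j ≠ 0 := by
      by_contra! h
      exact hw0 (by ext j; simpa using h j)
    exact Finset.sum_pos' (fun i _ => by positivity) ⟨j, Finset.mem_univ j, by positivity⟩
  have hline : ∀ v ∈ tangentVectors F Q,
      Tendsto (fun s : ℝ => Q + s • v) (𝓝 0) (𝓝[tangentHyperplane F Q] Q) := by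
    intro v hv
    refine tendsto_nhdsWithin_iff.2 ⟨Continuous.tendsto' (by fun_prop) _ _ (by simp),
      Eventually.of_forall fun s => ?_⟩
    change fderiv ℝ F Q (Q + s • v - Q) = 0
    rw [add_sub_cancel_left, map_smul, show fderiv ℝ F Q v = 0 from hv, smul_zero]
  have hnw : -w ∈ tangentVectors F Q := by
    change fderiv ℝ F Q (-w) = 0
    rw [map_neg, show fderiv ℝ F Q w = 0 from hw, neg_zero]
  have hlim : Tendsto (fun s : ℝ => 2 * C * ‖w‖ ^ (m + 1) * s ^ ((m : ℝ) + 1 - q)) (𝓝[>] 0)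
      (𝓝 0) := by
    have h0 : ContinuousAt (fun s : ℝ => s ^ ((m : ℝ) + 1 - q)) 0 :=
      Real.continuousAt_rpow_const _ _ (Or.inr (by linarith))
    have h1 := (h0.tendsto.const_mul (2 * C * ‖w‖ ^ (m + 1))).mono_left
      (nhdsWithin_le_nhds (s := Ioi 0))
    rwa [Real.zero_rpow (by linarith), mul_zero] at h1
  have hle : c * A ≤ 0 := by
    refine ge_of_tendsto hlim ?_
    filter_upwards [nhdsWithin_le_nhds ((hline w hw).eventually hC),
      nhdsWithin_le_nhds ((hline (-w) hnw).eventually hC), self_mem_nhdsWithin] with s h1 h2 hs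
    have hs0 : (0 : ℝ) < s := hs
    have h3 := hF (s • w)
    have h4 : ∑ j, |(s • w) j| ^ q = s ^ q * A := by
      rw [hA, Finset.mul_sum]
      refine Finset.sum_congr rfl fun j _ => ?_
      rw [PiLp.smul_apply, smul_eq_mul, abs_mul, abs_of_pos hs0,
        Real.mul_rpow hs0.le (abs_nonneg _)]
    rw [h4, hQ] at h3
    rw [add_sub_cancel_left, norm_smul, Real.norm_eq_abs, abs_of_pos hs0] at h1 h2
    rw [norm_neg, smul_neg, ← sub_eq_add_neg] at h2
    have h5 : s ^ q * (c * A) ≤ s ^ q * (2 * C * ‖w‖ ^ (m + 1) * s ^ ((m : ℝ) + 1 - q)) := by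
      have h6 : s ^ q * s ^ ((m : ℝ) + 1 - q) = s ^ (m + 1) := by
        rw [← Real.rpow_add hs0, ← Real.rpow_natCast]
        congr 1; push_cast; ring
      calc s ^ q * (c * A) = c * (s ^ q * A) := by ring
        _ ≤ F (Q + s • w) + F (Q - s • w) - 2 * 0 := h3
        _ ≤ C * (s * ‖w‖) ^ (m + 1) + C * (s * ‖w‖) ^ (m + 1) := by
          linarith [le_abs_self (F (Q + s • w)), le_abs_self (F (Q - s • w))]
        _ = 2 * C * ‖w‖ ^ (m + 1) * s ^ (m + 1) := by ring
        _ = _ := by rw [← h6]; ring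
    exact le_of_mul_le_mul_left h5 (Real.rpow_pos_of_pos hs0 q)
  exact absurd (mul_pos hc hApos) hle.not_gt

/-! ### Convex barriers -/

/-- A convex function that vanishes near the compact convex set `K` and is positive on the compact
set `S`, built from finitely many half-spaces containing `K`. -/
lemma exists_convex_barrier {E : Type*} [NormedAddCommGroup E] [NormedSpace ℝ E] {K S : Set E}
    (hKc : IsCompact K) (hK : Convex ℝ K) (hS : IsCompact S) (hKS : Disjoint K S) {n : ℕ}
    (hn : 1 ≤ n) :
    ∃ H : E → ℝ, ContDiff ℝ n H ∧ ConvexOn ℝ univ H ∧ (∀ x, 0 ≤ H x) ∧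
      (∃ U, IsOpen U ∧ K ⊆ U ∧ ∀ x ∈ U, H x = 0) ∧ ∀ x ∈ S, 0 < H x := by
  refine hS.induction_on (p := fun s => ∃ H : E → ℝ, ContDiff ℝ n H ∧ ConvexOn ℝ univ H ∧
    (∀ x, 0 ≤ H x) ∧ (∃ U, IsOpen U ∧ K ⊆ U ∧ ∀ x ∈ U, H x = 0) ∧ ∀ x ∈ s, 0 < H x) ?_ ?_ ?_ ?_
  · exact ⟨fun _ => 0, contDiff_const, convexOn_const 0 convex_univ, fun _ => le_rfl,
      ⟨univ, isOpen_univ, subset_univ _, fun _ _ => rfl⟩, by simp⟩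
  · rintro s t hst ⟨H, h1, h2, h3, h4, h5⟩
    exact ⟨H, h1, h2, h3, h4, fun x hx => h5 x (hst hx)⟩
  · rintro s t ⟨H, h1, h2, h3, ⟨U, h4, h5, h6⟩, h7⟩ ⟨H', h1', h2', h3', ⟨U', h4', h5', h6'⟩, h7'⟩
    refine ⟨fun x => H x + H' x, h1.add h1', h2.add h2', fun x => add_nonneg (h3 x) (h3' x),
      ⟨U ∩ U', h4.inter h4', subset_inter h5 h5', fun x hx => ?_⟩, ?_⟩
    · change H x + H' x = 0
      rw [h6 x hx.1, h6' x hx.2, add_zero]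
    · rintro x (hx | hx)
      · exact add_pos_of_pos_of_nonneg (h7 x hx) (h3' x)
      · exact add_pos_of_nonneg_of_pos (h3 x) (h7' x hx)
  · intro x hx
    obtain ⟨χ, hχ1, hχ2, hχ3, hχ4⟩ := exists_convex_cutoff n hn
    obtain ⟨f, a, hf, hfx⟩ := geometric_hahn_banach_closed_point hK hKc.isClosed
      (fun h => disjoint_left.1 hKS h hx)
    have hcd : ContDiff ℝ n fun z => χ (f z - a) := hχ1.comp (f.contDiff.sub contDiff_const)
    refine ⟨{z | 0 < χ (f z - a)}, mem_nhdsWithin_of_mem_nhds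
      ((isOpen_lt continuous_const hcd.continuous).mem_nhds (hχ4 _ (sub_pos.2 hfx))),
      fun z => χ (f z - a), hcd, ⟨convex_univ, fun y _ z _ b c hb hc hbc => ?_⟩, fun z => ?_,
      ⟨{z | f z < a}, isOpen_lt f.continuous continuous_const, hf, fun z hz => ?_⟩,
      fun z hz => hz⟩
    · have := hχ2.2 (mem_univ (f y - a)) (mem_univ (f z - a)) hb hc hbc
      refine le_trans (le_of_eq ?_) this
      dsimp only
      congr 1
      simp only [map_add, map_smul, smul_eq_mul]
      linear_combination a * hbc
    · rcases le_or_gt (f z - a) 0 with h | h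
      · exact (hχ3 _ h).ge
      · exact (hχ4 _ h).le
    · exact hχ3 _ (sub_nonpos.2 (le_of_lt hz))

/-! ### Supporting hyperplanes and the Hausdorff distance of the boundaries -/

lemma exists_unit_normal {N : ℕ} {Ω : Set (EuclideanSpace ℝ (Fin N))} (hopen : IsOpen Ω)
    (hconv : Convex ℝ Ω) {y : EuclideanSpace ℝ (Fin N)} (hy : y ∈ frontier Ω) :
    ∃ u : EuclideanSpace ℝ (Fin N), ‖u‖ = 1 ∧ ∀ a ∈ closure Ω, inner ℝ u (a - y) ≤ 0 := by
  have hyΩ : y ∉ Ω := by rw [hopen.frontier_eq] at hy; exact hy.2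
  obtain ⟨b, hb⟩ : Ω.Nonempty := closure_nonempty_iff.1 ⟨y, frontier_subset_closure hy⟩
  obtain ⟨f, hf⟩ := geometric_hahn_banach_open_point hconv hopen hyΩ
  set v := (InnerProductSpace.toDual ℝ (EuclideanSpace ℝ (Fin N))).symm f with hv
  have hvf : ∀ z, inner ℝ v z = f z := fun z => InnerProductSpace.toDual_symm_apply
  have hv0 : v ≠ 0 := by
    intro h0
    have := hf b hb
    rw [← hvf, ← hvf, h0, inner_zero_left, inner_zero_left] at this
    exact lt_irrefl _ this
  refine ⟨‖v‖⁻¹ • v, norm_smul_inv_norm (𝕜 := ℝ) hv0, fun a ha => ?_⟩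
  have hle : f a ≤ f y := closure_minimal (fun z hz => (hf z hz).le)
    (isClosed_le f.continuous continuous_const) ha
  rw [real_inner_smul_left, hvf, map_sub]
  exact mul_nonpos_of_nonneg_of_nonpos (by positivity) (sub_nonpos.2 hle)

lemma hausdorffEDist_frontier_le {N : ℕ} {Ω Ω' : Set (EuclideanSpace ℝ (Fin N))}
    (hopen : IsOpen Ω) (hne : Ω.Nonempty) (hconv : Convex ℝ Ω) (hopen' : IsOpen Ω')
    (hsub : closure Ω ⊆ Ω') {e : ℝ} (he : 0 < e) (hle : ∀ x ∈ Ω', infDist x (closure Ω) ≤ e) :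
    hausdorffEDist (frontier Ω') (frontier Ω) ≤ ENNReal.ofReal (2 * e) := by
  refine hausdorffEDist_le_of_mem_edist (fun x hx => ?_) (fun y hy => ?_)
  · have hxK : x ∉ closure Ω := fun h => (hopen'.frontier_eq ▸ hx).2 (hsub h)
    have hxe : infDist x (closure Ω) ≤ e :=
      closure_minimal hle (isClosed_le (continuous_infDist_pt _) continuous_const)
        (frontier_subset_closure hx)
    obtain ⟨y, hy, hxy⟩ := exists_mem_frontier_infDist_compl_eq_dist (s := (closure Ω)ᶜ) hxK
      (by simpa using hne.ne_empty)
    rw [compl_compl] at hxy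
    rw [frontier_compl] at hy
    refine ⟨y, frontier_closure_subset hy, ?_⟩
    rw [edist_dist, ← hxy]
    exact ENNReal.ofReal_le_ofReal (by linarith)
  · obtain ⟨u, hu, hnormal⟩ := exists_unit_normal hopen hconv hy
    have hyK : y ∈ closure Ω := frontier_subset_closure hy
    -- The point at height `2 * e` above `y` is too far away to lie in `Ω'`.
    have hz : y + (2 * e) • u ∉ Ω' := by
      intro h
      refine absurd (hle _ h) (not_le.2 (lt_of_lt_of_le (show e < 2 * e by linarith) ?_))
      refine (le_infDist ⟨y, hyK⟩).2 fun a ha => ?_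
      have h1 : inner ℝ u (y + (2 * e) • u - a) = 2 * e - inner ℝ u (a - y) := by
        rw [show y + (2 * e) • u - a = (2 * e) • u - (a - y) by abel, inner_sub_right,
          real_inner_smul_right, real_inner_self_eq_norm_sq, hu]
        ring
      have h2 := real_inner_le_norm u (y + (2 * e) • u - a)
      rw [hu, one_mul, h1] at h2
      rw [dist_eq_norm]
      linarith [hnormal a ha]
    obtain ⟨x, hx, hxf⟩ : (segment ℝ y (y + (2 * e) • u) ∩ frontier Ω').Nonempty := by
      by_contra hempty
      have hcover : segment ℝ y (y + (2 * e) • u) ⊆ Ω' ∪ (closure Ω')ᶜ := fun x hx => by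
        by_contra h
        rw [mem_union, not_or, notMem_compl_iff] at h
        exact hempty ⟨x, hx, hopen'.frontier_eq ▸ ⟨h.2, h.1⟩⟩
      have hend : y + (2 * e) • u ∈ (closure Ω')ᶜ :=
        (hcover (right_mem_segment ℝ _ _)).resolve_left hz
      obtain ⟨x, -, hx⟩ := (convex_segment y (y + (2 * e) • u)).isPreconnected _ _ hopen'
        isClosed_closure.isOpen_compl hcover ⟨y, left_mem_segment ℝ _ _, hsub hyK⟩
        ⟨_, right_mem_segment ℝ _ _, hend⟩
      exact hx.2 (subset_closure hx.1)
    refine ⟨x, hxf, ?_⟩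
    have hdist : dist x y ≤ dist (y + (2 * e) • u) y :=
      (convexOn_dist y convex_univ).le_max_of_mem_segment (mem_univ _) (mem_univ _) hx |>.trans
        (by simp)
    rw [dist_eq_norm (y + (2 * e) • u), add_sub_cancel_left, norm_smul, hu, mul_one,
      Real.norm_eq_abs, abs_of_pos (by positivity)] at hdist
    rw [edist_dist, dist_comm]
    exact ENNReal.ofReal_le_ofReal hdist

/-! ### The bumped domain -/

/-- A nonzero functional with a nontrivial kernel forces the dimension to be at least two, so that
every functional has a nontrivial kernel. -/
lemma exists_ne_zero_apply_eq_zero {E : Type*} [AddCommGroup E] [Module ℝ E] {L : E →ₗ[ℝ] ℝ}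
    (hL : L ≠ 0) {w : E} (hw : L w = 0) (hw0 : w ≠ 0) (L' : E →ₗ[ℝ] ℝ) : ∃ x, x ≠ 0 ∧ L' x = 0 := by
  obtain ⟨v, hv⟩ := DFunLike.ne_iff.1 hL
  by_cases h : L' w = 0
  · exact ⟨w, hw0, h⟩
  · refine ⟨v - (L' v / L' w) • w, fun h0 => hv ?_, ?_⟩
    · simpa [hw] using congrArg L h0
    · rw [map_sub, map_smul, smul_eq_mul, div_mul_cancel₀ _ h, sub_self]

lemma IsConvexOfOrder.exists_tangent_ne_zero {N m : ℕ} {Ω : Set (EuclideanSpace ℝ (Fin N))}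
    {P : EuclideanSpace ℝ (Fin N)} (hP : IsConvexOfOrder Ω P m)
    (L : EuclideanSpace ℝ (Fin N) →L[ℝ] ℝ) : ∃ w, w ≠ 0 ∧ L w = 0 := by
  obtain ⟨hPf, ρ, hρ, -, -, -, hnb⟩ := hP
  obtain ⟨w, hw, hw0⟩ : ∃ w ∈ tangentVectors ρ P, w ≠ 0 := by
    by_contra! h
    refine hnb ⟨0, ?_⟩
    filter_upwards [self_mem_nhdsWithin] with x hx
    have : x = P := sub_eq_zero.1 (h _ hx)
    rw [this, (hρ.eq_zero_iff P).2 hPf]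
    simp
  refine exists_ne_zero_apply_eq_zero (L := (fderiv ℝ ρ P).toLinearMap) (fun h0 => ?_) hw hw0
    L.toLinearMap
  exact hρ.fderiv_ne_zero P hPf (ContinuousLinearMap.coe_injective h0)

lemma IsConvexOfOrder.two_le {N m : ℕ} {Ω : Set (EuclideanSpace ℝ (Fin N))}
    {P : EuclideanSpace ℝ (Fin N)} (hP : IsConvexOfOrder Ω P m) : 2 ≤ m := by
  obtain ⟨hPf, ρ, hρ, hsm, -, -, hnb⟩ := hP
  by_contra! hm
  obtain ⟨C, hC⟩ := contactBound_two (hsm.of_le (by exact_mod_cast le_max_left 2 m))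
    ((hρ.eq_zero_iff P).2 hPf)
  refine hnb ⟨|C|, ?_⟩
  filter_upwards [hC, nhdsWithin_le_nhds (closedBall_mem_nhds P one_pos)] with x hx hx1
  refine hx.trans (mul_le_mul (le_abs_self C) ?_ (by positivity) (abs_nonneg C))
  exact pow_le_pow_of_le_one (norm_nonneg _) (by simpa [dist_eq_norm] using hx1) (by omega)

/-- The order of contact of a `C ^ m` convex level set at a point is found between `2` and `m`. -/
lemma exists_isConvexOfOrder_le {N m : ℕ} (hm : 2 ≤ m) {F : EuclideanSpace ℝ (Fin N) → ℝ}
    (hF : ContDiff ℝ (m : WithTop ℕ∞) F) (hconv : ConvexOn ℝ univ F)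
    {Ω : Set (EuclideanSpace ℝ (Fin N))} (hdef : IsDefiningFunction 1 Ω F)
    {Q : EuclideanSpace ℝ (Fin N)} (hQ : Q ∈ frontier Ω) (hnb : ¬ ContactBound F Q (m + 1)) :
    ∃ j ≤ m, IsConvexOfOrder Ω Q j := by
  have hF2 : ContDiff ℝ 2 F := hF.of_le (by exact_mod_cast hm)
  have h2 : ContactBound F Q 2 := contactBound_two hF2.contDiffAt ((hdef.eq_zero_iff Q).2 hQ)
  obtain ⟨j, hj2, hjm, hj, hj1⟩ :
      ∃ j, 2 ≤ j ∧ j ≤ m ∧ ContactBound F Q j ∧ ¬ ContactBound F Q (j + 1) := by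
    by_contra! h
    have hall : ∀ j, 2 ≤ j → j ≤ m + 1 → ContactBound F Q j := by
      intro j hj
      induction j, hj using Nat.le_induction with
      | base => exact fun _ => h2
      | succ j hj ih => exact fun hjm => h j hj (by omega) (ih (by omega))
    exact hnb (hall (m + 1) (by omega) le_rfl)
  refine ⟨j, hjm, hQ, F, hdef, ?_, hessianNonnegOnTangent_of_convexOn hF2 hconv Q, hj, hj1⟩
  rw [max_eq_right hj2]
  exact (hF.of_le (by exact_mod_cast hjm)).contDiffAt

lemma two_mul_le_add_of_convexOn {E : Type*} [AddCommGroup E] [Module ℝ E] {f : E → ℝ}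
    (hf : ConvexOn ℝ univ f) (x w : E) : 2 * f x ≤ f (x + w) + f (x - w) := by
  have h := hf.2 (mem_univ (x + w)) (mem_univ (x - w)) (show (0 : ℝ) ≤ 1 / 2 by norm_num)
    (show (0 : ℝ) ≤ 1 / 2 by norm_num) (by norm_num)
  rw [← smul_add, add_add_sub_cancel, ← two_smul ℝ x, smul_smul] at h
  norm_num at h
  linarith

/-- The data of the bumped domain: a convex function `F`, negative on the closure of `Ω` and
positive on the points at distance `e` from it, whose second differences are bounded below by
`q`-th powers, together with a zero `Q` off the closure of `Ω` at which this growth is exact on the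
tangent hyperplane. -/
lemma exists_convex_function {N n : ℕ} (hn : 2 ≤ n) {q : ℝ} (hq : 2 ≤ q)
    (hsmooth : ContDiff ℝ (n : WithTop ℕ∞) fun t : ℝ => |t| ^ q)
    {Ω : Set (EuclideanSpace ℝ (Fin N))} (hopen : IsOpen Ω) (hbdd : Bornology.IsBounded Ω)
    (hΩ : Convex ℝ Ω) {P : EuclideanSpace ℝ (Fin N)} (hP : P ∈ frontier Ω) {e : ℝ} (he : 0 < e) :
    ∃ (F : EuclideanSpace ℝ (Fin N) → ℝ) (Q : EuclideanSpace ℝ (Fin N)) (δ : ℝ),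
      0 < δ ∧ ContDiff ℝ (n : WithTop ℕ∞) F ∧ ConvexOn ℝ univ F ∧
      (∀ x ∈ closure Ω, F x < 0) ∧ (∀ x, infDist x (closure Ω) = e → 0 < F x) ∧
      (∀ x w : EuclideanSpace ℝ (Fin N),
        2 * δ * ∑ j, |w j| ^ q ≤ F (x + w) + F (x - w) - 2 * F x) ∧
      Q ∉ closure Ω ∧ F Q = 0 ∧
      ∀ᶠ x in 𝓝[tangentHyperplane F Q] Q, F x = δ * ∑ j, |(x - Q) j| ^ q := by
  set K := closure Ω with hK
  have hKc : IsCompact K := hbdd.isCompact_closure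
  have hPK : P ∈ K := frontier_subset_closure hP
  set S := {x | infDist x K = e} with hS
  have hSc : IsCompact S := (hKc.cthickening (r := 2 * e)).of_isClosed_subset
    (isClosed_eq (continuous_infDist_pt _) continuous_const)
    (fun x hx => thickening_subset_cthickening _ _
      ((mem_thickening_iff_infDist_lt ⟨P, hPK⟩).2 (by
        rw [show infDist x K = e from hx]; linarith)))
  have hKS : Disjoint K S := by
    rw [disjoint_left]
    intro x hx hxS
    have h : infDist x K = e := hxS
    rw [infDist_zero_of_mem hx] at h
    exact he.ne h
  obtain ⟨H, hH1, hH2, hH3, ⟨U, hU1, hU2, hU3⟩, hH5⟩ :=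
    exists_convex_barrier hKc hΩ.closure hSc hKS (n := n) (by omega)
  obtain ⟨u, hu, hnormal⟩ := exists_unit_normal hopen hΩ hP
  -- A height `t` above `P` at which the barrier `H` still vanishes.
  obtain ⟨t, htU, ht⟩ : ∃ t : ℝ, P + t • u ∈ U ∧ 0 < t := by
    have h : Tendsto (fun t : ℝ => P + t • u) (𝓝[>] 0) (𝓝 P) :=
      (Continuous.tendsto' (by fun_prop) _ _ (by simp)).mono_left nhdsWithin_le_nhds
    exact ((h.eventually (hU1.mem_nhds (hU2 hPK))).and self_mem_nhdsWithin).exists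
  set Q := P + t • u with hQ
  obtain ⟨χ, hχ1, hχ2, hχ3, hχ4⟩ := exists_convex_cutoff n (by omega)
  let ℓ : EuclideanSpace ℝ (Fin N) →L[ℝ] ℝ := innerSL ℝ u
  have hℓ : ∀ x, ℓ x = inner ℝ u x := fun x => rfl
  have hℓQ : ℓ (Q - P) = t := by
    rw [hℓ, hQ, add_sub_cancel_left, real_inner_smul_right, real_inner_self_eq_norm_sq, hu]
    ring
  obtain ⟨c, hc, hcS⟩ := hSc.exists_forall_le' hH1.continuous.continuousOn hH5
  -- The cap `L` creates the flat piece of the boundary through `Q`; the factor `B` makes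
  -- `B * L Q = c / 2`, so that `F Q = 0`.
  let B : ℝ := c / 2 / χ (t / 2)
  have hχt : 0 < χ (t / 2) := hχ4 _ (by positivity)
  have hB : 0 < B := by positivity
  have hBχ : B * χ (t / 2) = c / 2 := div_mul_cancel₀ _ hχt.ne'
  let L : EuclideanSpace ℝ (Fin N) → ℝ := fun x => χ (ℓ (x - P) - t / 2)
  have hχ0 : ∀ s, 0 ≤ χ s := fun s => by
    rcases le_or_gt s 0 with h | h
    · exact (hχ3 s h).ge
    · exact (hχ4 s h).le
  have hL1 : ContDiff ℝ n L := hχ1.comp (by fun_prop)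
  have hL2 : ConvexOn ℝ univ L := by
    refine ⟨convex_univ, fun y _ z _ a b ha hb hab => ?_⟩
    refine le_trans (le_of_eq ?_)
      (hχ2.2 (mem_univ (ℓ (y - P) - t / 2)) (mem_univ (ℓ (z - P) - t / 2)) ha hb hab)
    simp only [L]
    congr 1
    simp only [map_add, map_sub, map_smul, smul_eq_mul]
    linear_combination (ℓ P + t / 2) * hab
  have hL0 : ∀ x ∈ K, L x = 0 := fun x hx => hχ3 _ (by
    have := hnormal x hx
    rw [hℓ]; linarith)
  -- The strictly convex perturbation centred at `Q`.
  let Ψ : EuclideanSpace ℝ (Fin N) → ℝ := fun x => ∑ j, |(x - Q) j| ^ q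
  have hΨ1 : ContDiff ℝ n Ψ := by
    refine ContDiff.sum fun j _ => ?_
    refine hsmooth.comp (g := fun t : ℝ => |t| ^ q) ?_
    exact (EuclideanSpace.proj j : EuclideanSpace ℝ (Fin N) →L[ℝ] ℝ).contDiff.comp
      (contDiff_id.sub contDiff_const)
  have hΨ2 : ConvexOn ℝ univ Ψ := by
    refine ⟨convex_univ, fun y _ z _ a b ha hb hab => ?_⟩
    simp only [Ψ, smul_eq_mul, Finset.mul_sum, ← Finset.sum_add_distrib]
    refine Finset.sum_le_sum fun j _ => ?_
    refine le_trans (le_of_eq ?_) ((convexOn_abs_rpow (by linarith : 1 ≤ q)).2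
      (mem_univ ((y - Q) j)) (mem_univ ((z - Q) j)) ha hb hab)
    dsimp only
    congr 2
    simp only [PiLp.sub_apply, PiLp.add_apply, PiLp.smul_apply, smul_eq_mul]
    linear_combination (Q j) * hab
  have hΨ0 : ∀ x, 0 ≤ Ψ x := fun x => Finset.sum_nonneg fun j _ => by positivity
  have hΨQ : Ψ Q = 0 := by
    simp only [Ψ, sub_self]
    exact Finset.sum_eq_zero fun j _ => by
      rw [PiLp.zero_apply, abs_zero, Real.zero_rpow (by linarith)]
  have hΨd : ∀ x w : EuclideanSpace ℝ (Fin N),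
      2 * ∑ j, |w j| ^ q ≤ Ψ (x + w) + Ψ (x - w) - 2 * Ψ x := by
    intro x w
    simp only [Ψ, Finset.mul_sum, ← Finset.sum_add_distrib, ← Finset.sum_sub_distrib]
    refine Finset.sum_le_sum fun j _ => ?_
    have := two_mul_abs_rpow_add_le hq ((x - Q) j) (w j)
    rw [show (x + w - Q) j = (x - Q) j + w j by simp only [PiLp.sub_apply, PiLp.add_apply]; ring,
      show (x - w - Q) j = (x - Q) j - w j by simp only [PiLp.sub_apply]; ring]
    linarith
  obtain ⟨M, hM⟩ := hKc.exists_bound_of_continuousOn hΨ1.continuous.continuousOn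
  -- So small that `δ * Ψ` stays below `c / 2` on `K`.
  let δ : ℝ := c / (4 * (|M| + 1))
  have hδ : 0 < δ := by positivity
  have hδM : δ * (|M| + 1) = c / 4 := by simp only [δ]; field_simp
  let G : EuclideanSpace ℝ (Fin N) → ℝ := fun x => H x + δ * Ψ x
  let F : EuclideanSpace ℝ (Fin N) → ℝ := fun x => G x + (B * L x - c / 2)
  have hG1 : ContDiff ℝ n G := hH1.add (contDiff_const.mul hΨ1)
  have hF1 : ContDiff ℝ n F := hG1.add ((contDiff_const.mul hL1).sub contDiff_const)
  have hF2 : ConvexOn ℝ univ F :=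
    (hH2.add (hΨ2.smul hδ.le)).add ((hL2.smul hB.le).sub (concaveOn_const _ convex_univ))
  have hLQ : L Q = χ (t / 2) := by simp only [L, hℓQ]; congr 1; ring
  refine ⟨F, Q, δ, hδ, hF1, hF2, fun x hx => ?_, fun x hx => ?_, fun x w => ?_, fun hQK => ?_,
    ?_, ?_⟩
  · have h1 : Ψ x ≤ |M| := (le_abs_self _).trans ((hM x hx).trans (le_abs_self M))
    have h2 : δ * Ψ x ≤ δ * (|M| + 1) := by gcongr; linarith
    simp only [F, G, hU3 x (hU2 hx), hL0 x hx]
    linarith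
  · have h1 := hcS x hx
    have h2 := mul_nonneg hδ.le (hΨ0 x)
    have h3 : 0 ≤ B * L x := mul_nonneg hB.le (hχ0 _)
    simp only [F, G]
    linarith
  · have h1 := two_mul_le_add_of_convexOn hH2 x w
    have h2 := mul_le_mul_of_nonneg_left (two_mul_le_add_of_convexOn hL2 x w) hB.le
    have h3 := mul_le_mul_of_nonneg_left (hΨd x w) hδ.le
    simp only [F, G]
    linarith
  · have := hnormal Q hQK
    rw [← hℓ, hℓQ] at this
    exact this.not_gt ht
  · simp only [F, G, hU3 Q htU, hΨQ, hLQ, hBχ]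
    ring
  · -- On the tangent hyperplane at `Q` the functional `ℓ`, and hence `L`, is constant.
    have hGmin : IsLocalMin G Q := Eventually.of_forall fun x => by
      have h2 := mul_nonneg hδ.le (hΨ0 x)
      simp only [G, hU3 Q htU, hΨQ]
      linarith [hH3 x]
    have hχd : HasDerivAt χ (deriv χ (t / 2)) (ℓ (Q - P) - t / 2) := by
      rw [hℓQ, sub_half]
      exact (hχ1.differentiable (by norm_cast; omega) _).hasDerivAt
    have hLd : HasFDerivAt L (deriv χ (t / 2) • ℓ) Q := by
      refine hχd.comp_hasFDerivAt Q (HasFDerivAt.sub_const (t / 2) ?_)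
      have := (ℓ.hasFDerivAt (x := Q - P)).comp Q ((hasFDerivAt_id Q).sub_const P)
      rw [ContinuousLinearMap.comp_id] at this
      exact this
    have hFd : fderiv ℝ F Q = B • deriv χ (t / 2) • ℓ := by
      have hGd : HasFDerivAt G (0 : EuclideanSpace ℝ (Fin N) →L[ℝ] ℝ) Q := by
        have h := (hG1.differentiable (by norm_cast; omega) Q).hasFDerivAt
        rwa [hGmin.fderiv_eq_zero] at h
      have := (hGd.add ((hLd.const_mul B).sub_const (c / 2))).fderiv
      rw [zero_add] at this
      exact this
    have hχpos : deriv χ (t / 2) ≠ 0 := by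
      intro h0
      have h1 := hχ2.add_fderiv_le (hχ1.differentiable (by norm_cast; omega) (t / 2)) 0
      rw [fderiv_eq_smul_deriv, h0, smul_zero, hχ3 0 le_rfl] at h1
      linarith
    filter_upwards [self_mem_nhdsWithin, nhdsWithin_le_nhds (hU1.mem_nhds htU)] with x hx hxU
    have hx' : fderiv ℝ F Q (x - Q) = 0 := hx
    rw [hFd] at hx'
    have hℓx : ℓ (x - Q) = 0 := by
      simpa [hB.ne', hχpos] using hx'
    have hLx : L x = χ (t / 2) := by
      have : ℓ (x - P) = t := by
        rw [← sub_add_sub_cancel x Q P, map_add, hℓx, hℓQ, zero_add]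
      simp only [L, this]; congr 1; ring
    simp only [F, G, hU3 x hxU, hLx, hBχ, Ψ]
    ring

end ConvexBumping

open ConvexBumping

theorem mainTheorem11 {N k m : ℕ} (hk : 2 ≤ k)
    (Ω : Set (EuclideanSpace ℝ (Fin N)))
    (hopen : IsOpen Ω) (hbdd : Bornology.IsBounded Ω) (hconv : Convex ℝ Ω)
    (hCk : ConvexBumping.HasCkBoundary k Ω)
    (P : EuclideanSpace ℝ (Fin N)) (hP : ConvexBumping.IsConvexOfOrder Ω P m)
    (ε : ℝ) (hε : 0 < ε) :
    ∃ Ω' : Set (EuclideanSpace ℝ (Fin N)),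
      IsOpen Ω' ∧ IsConnected Ω' ∧ Bornology.IsBounded Ω' ∧ Convex ℝ Ω' ∧
      ConvexBumping.HasCkBoundary k Ω' ∧
      Ω ⊆ Ω' ∧
      P ∈ Ω' ∧
      (∀ Q ∈ frontier Ω' \ closure Ω, ∃ j ≤ m, ConvexBumping.IsConvexOfOrder Ω' Q j) ∧
      (∃ Q ∈ frontier Ω' \ closure Ω, ConvexBumping.IsConvexOfOrder Ω' Q m) ∧
      Metric.hausdorffEDist (frontier Ω') (frontier Ω) < ENNReal.ofReal ε := by
  have hm := hP.two_le
  have hm2 : (2 : ℝ) ≤ m := by exact_mod_cast hm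
  have hPcl : P ∈ closure Ω := frontier_subset_closure hP.1
  have hpar : Even m ∨ k ≤ m := by
    rcases lt_or_ge m k with h | h
    · exact Or.inl (hP.even_of_hasCkBoundary hopen hconv hCk h)
    · exact Or.inr h
  obtain ⟨q, hmq, hqm, hsmooth⟩ := exists_contDiff_abs_rpow hpar
  obtain ⟨F, Q, δ, hδ, hF1, hF2, hFK, hFS, hFd, hQ, hFQ, hflat⟩ :=
    exists_convex_function (hk.trans (le_max_left k m)) (hm2.trans hmq) hsmooth hopen hbdd hconv
      hP.1 (show 0 < ε / 3 by positivity)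
  have hdef := isDefiningFunction_of_convexOn (hk.trans (le_max_left k m) |>.trans' one_le_two)
    hF1 hF2 (hFK P hPcl)
  set Ω' := {x | F x < 0} with hΩ'
  have hdef1 : IsDefiningFunction 1 Ω' F := hdef.of_le (by omega)
  have hopen' : IsOpen Ω' := isOpen_lt hF1.continuous continuous_const
  have hconv' : Convex ℝ Ω' := by simpa using hF2.convex_lt 0
  have hsub : closure Ω ⊆ Ω' := fun x hx => hFK x hx
  have hFm : ContDiff ℝ (m : WithTop ℕ∞) F := hF1.of_le (by exact_mod_cast le_max_right k m)
  -- A segment from `P` that leaves the `ε / 3`-neighbourhood meets a point where `F` is positive.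
  have hdist : ∀ x ∈ Ω', Metric.infDist x (closure Ω) ≤ ε / 3 := by
    intro x hx
    by_contra! h
    obtain ⟨z, hz, hzd⟩ := (convex_segment P x).isPreconnected.intermediate_value
      (left_mem_segment ℝ P x) (right_mem_segment ℝ P x)
      (Metric.continuous_infDist_pt (closure Ω)).continuousOn
      ⟨(Metric.infDist_zero_of_mem hPcl).trans_le (by positivity), h.le⟩
    exact lt_asymm (hFS z hzd) (hconv'.segment_subset (hsub hPcl) hx hz)
  have hnb : ∀ R ∈ frontier Ω', ¬ ContactBound F R (m + 1) := by
    intro R hR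
    obtain ⟨w, hw0, hw⟩ := hP.exists_tangent_ne_zero (fderiv ℝ F R)
    exact not_contactBound_of_le_second_difference ((hdef1.eq_zero_iff R).2 hR) hqm
      (by positivity) (hFd R) hw hw0
  have hQf : Q ∈ frontier Ω' := (hdef1.eq_zero_iff Q).1 hFQ
  have hb : ContactBound F Q m := by
    refine ⟨δ * N, ?_⟩
    filter_upwards [hflat, nhdsWithin_le_nhds (Metric.closedBall_mem_nhds Q one_pos)]
      with x hx hx1
    have hx1' : ‖x - Q‖ ≤ 1 := by simpa [dist_eq_norm] using hx1
    have hsum : ∑ j, |(x - Q) j| ^ q ≤ ∑ _j : Fin N, ‖x - Q‖ ^ m := by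
      refine Finset.sum_le_sum fun j _ => ?_
      have hj : |(x - Q) j| ≤ ‖x - Q‖ := by
        simpa using PiLp.norm_apply_le (x - Q) j
      rw [← Real.rpow_natCast]
      calc |(x - Q) j| ^ q ≤ |(x - Q) j| ^ (m : ℝ) :=
            Real.rpow_le_rpow_of_exponent_ge_of_imp (abs_nonneg _) (hj.trans hx1') hmq
              (fun _ h => absurd h (by linarith))
        _ ≤ ‖x - Q‖ ^ (m : ℝ) := Real.rpow_le_rpow (abs_nonneg _) hj (by linarith)
    rw [Finset.sum_const, Finset.card_univ, Fintype.card_fin, nsmul_eq_mul] at hsum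
    have hnonneg : 0 ≤ ∑ j, |(x - Q) j| ^ q := Finset.sum_nonneg fun j _ => by positivity
    rw [hx, abs_of_nonneg (mul_nonneg hδ.le hnonneg), mul_assoc]
    exact mul_le_mul_of_nonneg_left hsum hδ.le
  refine ⟨Ω', hopen', ⟨⟨P, hsub hPcl⟩, hconv'.isPreconnected⟩, ?_, hconv',
    ⟨F, hdef.of_le (le_max_left k m)⟩, subset_closure.trans hsub, hsub hPcl,
    fun R hR => exists_isConvexOfOrder_le hm hFm hF2 hdef1 hR.1 (hnb R hR.1),
    ⟨Q, ⟨hQf, hQ⟩, hQf, F, hdef1, ?_, ?_, hb, hnb Q hQf⟩, ?_⟩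
  · refine (hbdd.closure.thickening (δ := ε)).subset fun x hx => ?_
    exact (Metric.mem_thickening_iff_infDist_lt ⟨P, hPcl⟩).2
      ((hdist x hx).trans_lt (by linarith))
  · rw [max_eq_right hm]
    exact hFm.contDiffAt
  · exact hessianNonnegOnTangent_of_convexOn (hFm.of_le (by exact_mod_cast hm)) hF2 Q
  · refine (hausdorffEDist_frontier_le hopen (closure_nonempty_iff.1 ⟨P, hPcl⟩) hconv hopen' hsub
      (by positivity) hdist).trans_lt ?_
    rw [ENNReal.ofReal_lt_ofReal_iff hε]
    linarith
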